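/- Let $\mathcal H_{\rm gr}=\ell^2(\mathbb R)$ be the Hilbert space with orthonormal basis $|v\rangle$, $v\in\mathbb R$, and write $\hat{\rm h}_\nu|v\rangle=|v+\nu\rangle$ and $Q(\hat v)|v\rangle=Q(v)|v\rangle$ for $Q:\mathbb R\to\mathbb R$. Let $\epsilon\in\mathbb R$ be such that $4n+\epsilon\neq0$ for all $n\in\mathbb Z$ (for instance $\epsilon\in(0,4)$), let $D_\epsilon={\rm span}\{|4n+\epsilon\rangle : n\in\mathbb Z\}$ and $\mathcal H_\epsilon=\overline{D_\epsilon}$. Let $G>0$, $\alpha\in\mathbb R$, $\tilde\Lambda>0$, and let $\tilde A,\tilde B:\mathbb R\to\mathbb R$ satisfy $$\tilde A(v)=\tfrac34\pi G|v|+o_0(v),\qquad \tilde B(v)=\frac1{|v|}\Big(1+\frac{\alpha}{|v|^2}+O\big(\tfrac1{v^4}\big)\Big)\quad(|v|\to\infty),$$ where $o_0$ has compact support, and $\tilde B(4n+\epsilon)>0$ for all $n\in\mathbb Z$. Consider in $\mathcal H_\epsilon$ the operator $$H_{\rm APS}=\tilde B(\hat v)^{-1/2}\big(-\hat{\rm h}_2\tilde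 A(\hat v)\hat{\rm h}_2-\hat{\rm h}_{-2}\tilde A(\hat v)\hat{\rm h}_{-2}+\tilde A(\hat v+2)+\tilde A(\hat v-2)+\tilde\Lambda|\hat v|\big)\tilde B(\hat v)^{-1/2}$$ with domain $D_\epsilon$. Then: (i) $H_{\rm APS}$ is essentially self-adjoint; (ii) its closure has purely discrete spectrum: every point of the spectrum is isolated in the spectrum and is an eigenvalue of finite multiplicity. If moreover $\tilde A(4n+\epsilon+2)\ge0$ for all $n\in\mathbb Z$, then: (iii) the spectrum of the closure is contained in $(0,\infty)$; (iv) for every $E\in\mathbb R$ the dimension of the closed subspace spanned by the eigenvectors of the closure with eigenvalue $\lambda<E$ is at most the number of elements of $$\Big\{n\in\mathbb Z : \tilde\Lambda\,\frac{|4n+\epsilon|}{\tilde B(4n+\epsilon)}<E\Big\}.$$ -/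

import Mathlib

open scoped InnerProductSpace

noncomputable section

namespace LinearPMap

variable {H : Type*} [NormedAddCommGroup H] [InnerProductSpace ℂ H]

/-- An unbounded operator is essentially self-adjoint if it is densely defined, symmetric, and its
closure is self-adjoint. -/
def IsEssentiallySelfAdjoint [CompleteSpace H] (T : H →ₗ.[ℂ] H) : Prop :=
  Dense (T.domain : Set H) ∧ T.IsFormalAdjoint T ∧ IsSelfAdjoint T.closure

/-- The resolvent set of an unbounded operator: the `z` for which `T - z`, as a map from the domain
of `T` to `H`, has a bounded everywhere defined two-sided inverse `R`. -/
def resolventSet (T : H →ₗ.[ℂ] H) : Set ℂ :=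
  {z | ∃ R : H →L[ℂ] H,
    (∀ y : H, ∃ x : T.domain, (x : H) = R y ∧ T x - z • (x : H) = y) ∧
    ∀ x : T.domain, R (T x - z • (x : H)) = x}

/-- The spectrum of an unbounded operator. -/
def spectrum (T : H →ₗ.[ℂ] H) : Set ℂ :=
  T.resolventSetᶜ

/-- The eigenspace of an unbounded operator; it consists of vectors of the domain. -/
def eigenspace (T : H →ₗ.[ℂ] H) (z : ℂ) : Submodule ℂ H :=
  (LinearMap.ker (T.toFun - z • T.domain.subtype)).map T.domain.subtype

/-- Purely discrete spectrum: each point of the spectrum is isolated in the spectrum and is an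
eigenvalue of finite multiplicity. -/
def HasPurelyDiscreteSpectrum (T : H →ₗ.[ℂ] H) : Prop :=
  ∀ z ∈ T.spectrum,
    (∃ U : Set ℂ, IsOpen U ∧ U ∩ T.spectrum = {z}) ∧
    T.eigenspace z ≠ ⊥ ∧
    FiniteDimensional ℂ (T.eigenspace z)

/-- The closed subspace spanned by the eigenvectors whose (real) eigenvalue is less than `E`. -/
def eigenspacesBelow (T : H →ₗ.[ℂ] H) (E : ℝ) : Submodule ℂ H :=
  (⨆ lam : {lam : ℝ // lam < E}, T.eigenspace ((lam : ℝ) : ℂ)).topologicalClosure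

end LinearPMap

namespace LQC

/-- The kinematical gravitational Hilbert space `ℓ²(ℝ)`, with orthonormal basis `|v⟩`, `v : ℝ`. -/
abbrev Hgr : Type := lp (fun _ : ℝ => ℂ) 2

/-- The basis vector `|v⟩`. -/
def ket (v : ℝ) : Hgr := lp.single 2 v 1

/-- The span of the vectors `|4n + ε⟩`, `n : ℤ`. -/
def Deps (ε : ℝ) : Submodule ℂ Hgr :=
  Submodule.span ℂ (Set.range fun n : ℤ => ket (4 * n + ε))

/-- The Hilbert space of the sector `ε`: the closure of `Deps ε`. -/
abbrev Heps (ε : ℝ) : Submodule ℂ Hgr := (Deps ε).topologicalClosure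

/-- The operator `Q(v̂)`, that is `|v⟩ ↦ Q v |v⟩`, on the level of coefficient functions. -/
def mulOp (Q : ℝ → ℝ) : (ℝ → ℂ) →ₗ[ℂ] (ℝ → ℂ) where
  toFun ψ := fun v => (Q v : ℂ) * ψ v
  map_add' ψ φ := by ext v; simp [mul_add]
  map_smul' c ψ := by ext v; simp [mul_left_comm]

/-- The holonomy operator `|v⟩ ↦ |v + ν⟩`, on the level of coefficient functions. -/
def holonomy (ν : ℝ) : (ℝ → ℂ) →ₗ[ℂ] (ℝ → ℂ) where
  toFun ψ := fun v => ψ (v - ν)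
  map_add' ψ φ := by ext v; simp
  map_smul' c ψ := by ext v; simp

/-- The expression
`B(v̂)^(-1/2) (-h₂ A(v̂) h₂ - h₋₂ A(v̂) h₋₂ + A(v̂+2) + A(v̂-2) + Λ|v̂|) B(v̂)^(-1/2)`
acting on coefficient functions. -/
def formalHAPS (A B : ℝ → ℝ) (Λ : ℝ) : (ℝ → ℂ) →ₗ[ℂ] (ℝ → ℂ) :=
  mulOp (fun v => (√(B v))⁻¹) ∘ₗ
    (-(holonomy 2 ∘ₗ mulOp A ∘ₗ holonomy 2) - holonomy (-2) ∘ₗ mulOp A ∘ₗ holonomy (-2)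
      + mulOp (fun v => A (v + 2)) + mulOp (fun v => A (v - 2)) + mulOp (fun v => Λ * |v|)) ∘ₗ
    mulOp (fun v => (√(B v))⁻¹)

theorem ket_apply (v w : ℝ) : (ket v : ℝ → ℂ) w = if w = v then 1 else 0 := by
  simp [ket, Pi.single_apply]

theorem mulOp_ket (Q : ℝ → ℝ) (v : ℝ) :
    mulOp Q (ket v : ℝ → ℂ) = (Q v : ℂ) • (ket v : ℝ → ℂ) := by
  ext w
  by_cases h : w = v <;> simp [mulOp, ket_apply, h]

theorem holonomy_ket (ν v : ℝ) : holonomy ν (ket v : ℝ → ℂ) = (ket (v + ν) : ℝ → ℂ) := by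
  ext w
  simp [holonomy, ket_apply, sub_eq_iff_eq_add]

/-- The formal expression preserves `Deps ε`. -/
theorem formalHAPS_mem (A B : ℝ → ℝ) (Λ ε : ℝ) {ψ : Hgr} (hψ : ψ ∈ Deps ε) :
    ∃ φ ∈ Deps ε, (φ : ℝ → ℂ) = formalHAPS A B Λ ψ := by
  induction hψ using Submodule.span_induction with
  | mem x hx =>
    obtain ⟨n, rfl⟩ := hx
    have hk : ∀ m : ℤ, ket (4 * m + ε) ∈ Deps ε := fun m => Submodule.subset_span ⟨m, rfl⟩
    set v : ℝ := 4 * n + ε with hv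
    have h0 : ket v ∈ Deps ε := hk n
    have h1 : ket (v + 2 + 2) ∈ Deps ε := by
      have := hk (n + 1); push_cast at this; convert this using 2; rw [hv]; ring
    have h2 : ket (v + -2 + -2) ∈ Deps ε := by
      have := hk (n - 1); push_cast at this; convert this using 2; rw [hv]; ring
    set b : ℝ → ℂ := fun w => (((√(B w))⁻¹ : ℝ) : ℂ)
    refine ⟨b v • (-((A (v + 2) : ℂ) • b (v + 2 + 2) • ket (v + 2 + 2))
      - (A (v + -2) : ℂ) • b (v + -2 + -2) • ket (v + -2 + -2)
      + (A (v + 2) : ℂ) • b v • ket v + (A (v - 2) : ℂ) • b v • ket v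
      + ((Λ * |v| : ℝ) : ℂ) • b v • ket v), ?_, ?_⟩
    · refine Submodule.smul_mem _ _ (add_mem (add_mem (add_mem (sub_mem (neg_mem ?_) ?_) ?_) ?_) ?_)
      all_goals
        refine Submodule.smul_mem _ _ (Submodule.smul_mem _ _ ?_)
        assumption
    · simp only [formalHAPS, LinearMap.comp_apply, mulOp_ket, map_smul, LinearMap.add_apply,
        LinearMap.sub_apply, LinearMap.neg_apply, holonomy_ket, map_add, map_sub, map_neg]
      rfl
  | zero => exact ⟨0, zero_mem _, (map_zero (formalHAPS A B Λ)).symm⟩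
  | add x y _ _ hx hy =>
    obtain ⟨φ, hφ, e⟩ := hx
    obtain ⟨χ, hχ, e'⟩ := hy
    exact ⟨φ + χ, add_mem hφ hχ, by
      rw [lp.coeFn_add, e, e']; exact (map_add (formalHAPS A B Λ) _ _).symm⟩
  | smul c x _ hx =>
    obtain ⟨φ, hφ, e⟩ := hx
    exact ⟨c • φ, Submodule.smul_mem _ _ hφ, by
      rw [lp.coeFn_smul, e]; exact (map_smul (formalHAPS A B Λ) c _).symm⟩

theorem formalHAPS_memℓp (A B : ℝ → ℝ) (Λ ε : ℝ) {ψ : Hgr} (hψ : ψ ∈ Deps ε) :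
    Memℓp (E := fun _ : ℝ => ℂ) (formalHAPS A B Λ ψ) 2 := by
  obtain ⟨φ, -, e⟩ := formalHAPS_mem A B Λ ε hψ
  exact e ▸ lp.memℓp φ

theorem formalHAPS_mem_Heps (A B : ℝ → ℝ) (Λ ε : ℝ) {ψ : Hgr} (hψ : ψ ∈ Deps ε) :
    (⟨formalHAPS A B Λ ψ, formalHAPS_memℓp A B Λ ε hψ⟩ : Hgr) ∈ Heps ε := by
  obtain ⟨φ, hφ, e⟩ := formalHAPS_mem A B Λ ε hψ
  have : (⟨formalHAPS A B Λ ψ, formalHAPS_memℓp A B Λ ε hψ⟩ : Hgr) = φ := Subtype.ext e.symm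
  exact this ▸ (Deps ε).le_topologicalClosure hφ

/-- The generalized APS operator in the Hilbert space `Heps ε`, with domain `Deps ε`. -/
def HAPS (A B : ℝ → ℝ) (Λ ε : ℝ) : Heps ε →ₗ.[ℂ] Heps ε where
  domain := (Deps ε).comap (Heps ε).subtype
  toFun :=
    { toFun := fun ψ =>
        ⟨⟨formalHAPS A B Λ ((ψ : Heps ε) : Hgr), formalHAPS_memℓp A B Λ ε ψ.2⟩,
          formalHAPS_mem_Heps A B Λ ε ψ.2⟩
      map_add' := fun _ _ => Subtype.ext (Subtype.ext (map_add (formalHAPS A B Λ) _ _))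
      map_smul' := fun c _ => Subtype.ext (Subtype.ext (map_smul (formalHAPS A B Λ) c _)) }

end LQC

end

/-!
In the orthonormal basis `|4n + ε⟩` the operator is a Jacobi matrix. With `c = 3πG/4`, its diagonal
entries grow like `(2c + Λ) v²` and its off-diagonal ones like `-c v²`. Since `2c < 2c + Λ`, after
adding a large constant `μ` the off-diagonal part equals `-W D`, where `D` is the diagonal part and
`‖W‖ < 1`. A Neumann series thus gives the inverse `D⁻¹ (1 - W)⁻¹` of `H + μ = (1 - W) D`, which is
compact because `D⁻¹` is; this proves (i) and (ii).

Summation by parts turns the quadratic form into `⟪x, H x⟫ = ∑ A(v + 2) |ψ(v) - ψ(v + 4)|² +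
∑ Λ (|v| / B(v)) |x(v)|²` with `ψ = B^(-1/2) x` and `v` running over the lattice. For `A ≥ 0` the
form is bounded below by its potential term, which gives (iii), and a combination of eigenvectors of
energy below `E` that vanishes at all lattice points where the potential is below `E` must be zero,
which gives (iv).
-/

section Graph

variable {H : Type*} [NormedAddCommGroup H] [InnerProductSpace ℂ H] {T : H →ₗ.[ℂ] H}

theorem mem_eigenspace_iff_mem_graph {z : ℂ} {x : H} :
    x ∈ T.eigenspace z ↔ (x, z • x) ∈ T.graph := by
  simp only [LinearPMap.eigenspace, Submodule.mem_map, LinearMap.mem_ker, LinearMap.sub_apply,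
    LinearMap.smul_apply, sub_eq_zero, LinearPMap.mem_graph_iff]
  constructor
  · rintro ⟨y, hy, rfl⟩
    exact ⟨y, rfl, hy⟩
  · rintro ⟨y, rfl, hy⟩
    exact ⟨y, hy, rfl⟩

theorem inner_eq_of_mem_graph (hT : T.IsFormalAdjoint T) {p q : H × H} (hp : p ∈ T.graph)
    (hq : q ∈ T.graph) : ⟪p.2, q.1⟫_ℂ = ⟪p.1, q.2⟫_ℂ := by
  obtain ⟨x, hx, hx'⟩ := T.mem_graph_iff.1 hp
  obtain ⟨y, hy, hy'⟩ := T.mem_graph_iff.1 hq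
  rw [← hx, ← hx', ← hy, ← hy', hT x y]

theorem isClosable_of_isFormalAdjoint_self [CompleteSpace H] (hd : Dense (T.domain : Set H))
    (hT : T.IsFormalAdjoint T) : T.IsClosable :=
  (LinearPMap.adjoint_isClosed hd).isClosable.leIsClosable (hT.le_adjoint hd)

theorem mem_of_mem_graph_closure (hc : T.IsClosable) {s : Set (H × H)} (hs : IsClosed s)
    (h : ∀ x : T.domain, ((x : H), T x) ∈ s) {p : H × H} (hp : p ∈ T.closure.graph) : p ∈ s := by
  rw [← hc.graph_closure_eq_closure_graph, ← SetLike.mem_coe,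
    Submodule.topologicalClosure_coe] at hp
  refine closure_minimal (fun q hq => ?_) hs hp
  obtain ⟨x, hx, hx'⟩ := T.mem_graph_iff.1 hq
  simpa only [hx, hx'] using h x

theorem isFormalAdjoint_closure (hc : T.IsClosable) (hT : T.IsFormalAdjoint T) :
    T.closure.IsFormalAdjoint T.closure := by
  have hleft (x : T.domain) {q : H × H} (hq : q ∈ T.closure.graph) :
      ⟪T x, q.1⟫_ℂ = ⟪(x : H), q.2⟫_ℂ :=
    mem_of_mem_graph_closure hc (s := {q | ⟪T x, q.1⟫_ℂ = ⟪(x : H), q.2⟫_ℂ})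
      (isClosed_eq (by fun_prop) (by fun_prop)) (hT x) hq
  intro x y
  exact mem_of_mem_graph_closure hc (s := {p | ⟪p.2, (y : H)⟫_ℂ = ⟪p.1, T.closure y⟫_ℂ})
    (isClosed_eq (by fun_prop) (by fun_prop)) (fun x => hleft x (T.closure.mem_graph y))
    (T.closure.mem_graph x)

theorem le_re_inner_add_of_mem_graph_closure (hc : T.IsClosable) {E : ℝ} {φ : H → ℝ}
    (hφ : Continuous φ)
    (h : ∀ x : T.domain, E * ‖(x : H)‖ ^ 2 ≤ (⟪(x : H), T x⟫_ℂ).re + φ x) {p : H × H}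
    (hp : p ∈ T.closure.graph) : E * ‖p.1‖ ^ 2 ≤ (⟪p.1, p.2⟫_ℂ).re + φ p.1 :=
  mem_of_mem_graph_closure hc
    (s := {p | E * ‖p.1‖ ^ 2 ≤ (⟪p.1, p.2⟫_ℂ).re + φ p.1})
    (isClosed_le (by fun_prop) (by fun_prop)) h hp

end Graph

section CompactSymmetric

variable {𝕜 H : Type*} [RCLike 𝕜] [NormedAddCommGroup H] [InnerProductSpace 𝕜 H] {R : H →L[𝕜] H}

theorem exists_le_norm_sub_of_hasEigenvalue [CompleteSpace H] (hR : IsCompactOperator R)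
    (hRs : (R : H →ₗ[𝕜] H).IsSymmetric) {l : 𝕜} (hl : l ≠ 0) :
    ∃ c > 0, ∀ l', l' ≠ l → Module.End.HasEigenvalue (R : Module.End 𝕜 H) l' → c ≤ ‖l' - l‖ := by
  set V := (Module.End.eigenspace (R : Module.End 𝕜 H) l)ᗮ
  have hinv : ∀ v ∈ V, R v ∈ V := hRs.invariant_orthogonalComplement_eigenspace l
  have hne : ¬ Module.End.HasEigenvalue (R.restrict hinv : Module.End 𝕜 V) l := fun h =>
    Module.End.hasEigenvalue_iff.1 h
      (Module.End.eigenspace_restrict_eq_bot hinv (Submodule.orthogonal_disjoint _))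
  have hRV : IsCompactOperator (R.restrict hinv) := hR.restrict' hinv
  obtain ⟨K, hK⟩ := hRV.antilipschitz_of_not_hasEigenvalue hl hne
  obtain ⟨c, hc, hcK⟩ := antilipschitzWith_iff_exists_mul_le_norm.1 ⟨K, hK⟩
  refine ⟨c, hc, fun l' hl' h => ?_⟩
  obtain ⟨x, hx⟩ := h.exists_hasEigenvector
  have hxV : x ∈ V := (Submodule.mem_orthogonal _ _).2 fun u hu =>
    hRs.orthogonalFamily_eigenspaces hl'.symm ⟨u, hu⟩ ⟨x, hx.1⟩
  have hRx : (R.restrict hinv - l • 1) (⟨x, hxV⟩ : V) = (l' - l) • ⟨x, hxV⟩ := by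
    ext
    simpa [sub_smul] using hx.apply_eq_smul
  have hle := hcK ⟨x, hxV⟩
  rw [hRx, norm_smul] at hle
  exact le_of_mul_le_mul_right hle (norm_pos_iff.2 fun h => hx.2 (congrArg Subtype.val h))

end CompactSymmetric

section ShiftInverse

variable {H : Type*} [NormedAddCommGroup H] [InnerProductSpace ℂ H] {T : H →ₗ.[ℂ] H}
  {R : H →L[ℂ] H} {μ : ℂ}

/-- `R` is an everywhere defined bounded inverse of `T + μ`. Phrasing this through the graph of `T`
avoids having to show beforehand that `R` takes values in the domain of `T`. -/
def IsShiftInverse (T : H →ₗ.[ℂ] H) (μ : ℂ) (R : H →L[ℂ] H) : Prop :=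
  ∀ x w : H, (x, w) ∈ T.graph ↔ R (w + μ • x) = x

namespace IsShiftInverse

theorem mem_graph (hT : IsShiftInverse T μ R) (y : H) : (R y, y - μ • R y) ∈ T.graph := by
  rw [hT, sub_add_cancel]

theorem mem_eigenspace_iff (hT : IsShiftInverse T μ R) {z : ℂ} {x : H} :
    x ∈ T.eigenspace z ↔ (z + μ) • R x = x := by
  rw [mem_eigenspace_iff_mem_graph, hT, ← add_smul, map_smul]

theorem eigenspace_eq (hT : IsShiftInverse T μ R) {z : ℂ} (hz : z + μ ≠ 0) :
    T.eigenspace z = Module.End.eigenspace (R : Module.End ℂ H) (z + μ)⁻¹ := by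
  ext x
  rw [hT.mem_eigenspace_iff, Module.End.mem_eigenspace_iff]
  exact (eq_inv_smul_iff₀ hz).symm

theorem eigenspace_neg (hT : IsShiftInverse T μ R) : T.eigenspace (-μ) = ⊥ := by
  rw [Submodule.eq_bot_iff]
  intro x hx
  simpa [eq_comm] using hT.mem_eigenspace_iff.1 hx

theorem mem_resolventSet_of_isUnit (hT : IsShiftInverse T μ R) {z : ℂ}
    (hz : IsUnit (1 - (z + μ) • R)) : z ∈ T.resolventSet := by
  obtain ⟨S, hS, hS'⟩ := isUnit_iff_exists.1 hz
  have hright (y : H) : S y - (z + μ) • R (S y) = y := congr($hS y)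
  have hleft (y : H) : S (y - (z + μ) • R y) = y := congr($hS' y)
  refine ⟨R * S, fun y => ?_, fun x => ?_⟩
  · obtain ⟨x, hx, hTx⟩ := T.mem_graph_iff.1 (hT.mem_graph (S y))
    refine ⟨x, hx, ?_⟩
    simp only at hx hTx
    rw [hTx, hx, sub_sub, ← add_smul, add_comm μ z, hright]
  · have hx : R (T x + μ • (x : H)) = x := (hT x (T x)).1 (T.mem_graph x)
    have hsub : T x - z • (x : H) =
        T x + μ • (x : H) - (z + μ) • R (T x + μ • (x : H)) := by
      rw [hx]
      module
    rw [hsub, mul_apply_eq_comp, hleft, hx]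

theorem mem_resolventSet_of_eigenspace_eq_bot [CompleteSpace H] (hT : IsShiftInverse T μ R)
    (hR : IsCompactOperator R) {z : ℂ} (hz : T.eigenspace z = ⊥) : z ∈ T.resolventSet := by
  apply hT.mem_resolventSet_of_isUnit
  by_cases h : z + μ = 0
  · simp [h]
  have hmem : (z + μ)⁻¹ ∈ resolventSet ℂ R := by
    refine (hR.hasEigenvalue_or_mem_resolventSet (inv_ne_zero h)).resolve_left ?_
    rw [Module.End.hasEigenvalue_iff, ← hT.eigenspace_eq h, hz]
    exact not_not.2 rfl
  have hfactor : 1 - (z + μ) • R =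
      Units.mk0 _ h • (algebraMap ℂ (H →L[ℂ] H) (z + μ)⁻¹ - R) := by
    rw [Units.smul_mk0, smul_sub, Algebra.algebraMap_eq_smul_one, smul_inv_smul₀ h]
  rw [hfactor]
  exact (spectrum.mem_resolventSet_iff.1 hmem).smul _

theorem isSelfAdjoint [CompleteSpace H] {μ : ℝ} (hT : IsShiftInverse T μ R)
    (hR : (R : H →ₗ[ℂ] H).IsSymmetric) (hd : Dense (T.domain : Set H)) : IsSelfAdjoint T := by
  have hinner (g x w : H) : ⟪g - (μ : ℂ) • R g, x⟫_ℂ - ⟪R g, w⟫_ℂ =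
      ⟪g, x - R (w + (μ : ℂ) • x)⟫_ℂ := by
    have hRg (y : H) : ⟪R g, y⟫_ℂ = ⟪g, R y⟫_ℂ := hR g y
    simp only [inner_sub_left, inner_sub_right, inner_smul_left, inner_smul_right, inner_add_right,
      Complex.conj_ofReal, hRg, map_add, map_smul]
    ring
  rw [LinearPMap.isSelfAdjoint_def]
  apply LinearPMap.eq_of_eq_graph
  rw [LinearPMap.adjoint_graph_eq_graph_adjoint hd]
  ext ⟨x, w⟩
  rw [Submodule.mem_adjoint_iff, hT]
  constructor
  · intro h
    have hzero (g : H) : ⟪g, x - R (w + (μ : ℂ) • x)⟫_ℂ = 0 :=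
      (hinner g x w).symm.trans (h _ _ (hT.mem_graph g))
    exact (sub_eq_zero.1 (inner_self_eq_zero.1 (hzero _))).symm
  · intro h a b hab
    have hb : b = (b + (μ : ℂ) • a) - (μ : ℂ) • R (b + (μ : ℂ) • a) := by
      rw [(hT a b).1 hab, add_sub_cancel_right]
    have hzero := hinner (b + (μ : ℂ) • a) x w
    rwa [← hb, (hT a b).1 hab, h, sub_self, inner_zero_right] at hzero

theorem hasPurelyDiscreteSpectrum [CompleteSpace H] (hT : IsShiftInverse T μ R)
    (hR : IsCompactOperator R) (hRs : (R : H →ₗ[ℂ] H).IsSymmetric) :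
    T.HasPurelyDiscreteSpectrum := by
  have hspec {z : ℂ} (hz : z ∈ T.spectrum) : T.eigenspace z ≠ ⊥ ∧ z + μ ≠ 0 := by
    have hne : T.eigenspace z ≠ ⊥ := fun h => hz (hT.mem_resolventSet_of_eigenspace_eq_bot hR h)
    refine ⟨hne, fun h0 => hne ?_⟩
    rw [eq_neg_of_add_eq_zero_left h0, hT.eigenspace_neg]
  intro z hz
  obtain ⟨hz_ne, hzμ⟩ := hspec hz
  refine ⟨?_, hz_ne, ?_⟩
  · obtain ⟨c, hc, hgap⟩ := exists_le_norm_sub_of_hasEigenvalue hR hRs (inv_ne_zero hzμ)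
    have hcont : ContinuousAt (fun z' : ℂ => ‖(z' + μ)⁻¹ - (z + μ)⁻¹‖) z :=
      (((continuousAt_id.add continuousAt_const).inv₀ hzμ).sub continuousAt_const).norm
    obtain ⟨U, hUlt, hU, hzU⟩ :=
      mem_nhds_iff.1 (hcont.eventually_lt_const (u := c) (by simpa using hc))
    refine ⟨U, hU, Set.eq_singleton_iff_unique_mem.2 ⟨⟨hzU, hz⟩, ?_⟩⟩
    rintro z' ⟨hz'U, hz'⟩
    by_contra hne
    obtain ⟨hz'_ne, hz'μ⟩ := hspec hz'
    rw [hT.eigenspace_eq hz'μ] at hz'_ne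
    refine (hUlt hz'U).not_ge (hgap _ (fun h => hne ?_) (Module.End.hasEigenvalue_iff.2 hz'_ne))
    exact add_right_cancel (inv_injective h)
  · rw [hT.eigenspace_eq hzμ]
    exact ContinuousLinearMap.finite_dimensional_eigenspace hR _ (inv_ne_zero hzμ)

end IsShiftInverse

theorem isShiftInverse_closure (hc : T.IsClosable)
    (hR : ∀ x : T.domain, R (T x + μ • (x : H)) = x)
    (hr : DenseRange fun x : T.domain => T x + μ • (x : H)) : IsShiftInverse T.closure μ R := by
  intro x w
  constructor
  · exact fun h => mem_of_mem_graph_closure hc (s := {p | R (p.2 + μ • p.1) = p.1})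
      (isClosed_eq (by fun_prop) (by fun_prop)) hR h
  · intro h
    have hmem : (R (w + μ • x), w + μ • x - μ • R (w + μ • x)) ∈ closure (T.graph : Set (H × H)) :=
      map_mem_closure (f := fun g : H => (R g, g - μ • R g)) (by fun_prop) (hr (w + μ • x)) <| by
        rintro _ ⟨y, rfl⟩
        simp [hR]
    rw [← hc.graph_closure_eq_closure_graph, ← SetLike.mem_coe, Submodule.topologicalClosure_coe]
    simpa [h] using hmem

theorem isSymmetric_of_isFormalAdjoint {μ : ℝ} (hT : T.IsFormalAdjoint T)
    (hR : ∀ x : T.domain, R (T x + (μ : ℂ) • (x : H)) = x)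
    (hr : DenseRange fun x : T.domain => T x + (μ : ℂ) • (x : H)) :
    (R : H →ₗ[ℂ] H).IsSymmetric := by
  intro x y
  refine hr.induction_on₂ (p := fun x y => ⟪R x, y⟫_ℂ = ⟪x, R y⟫_ℂ) ?_ (fun x y => ?_) x y
  · exact isClosed_eq (by fun_prop) (by fun_prop)
  · simp only [hR, inner_add_left, inner_add_right, inner_smul_left, inner_smul_right, hT x y,
      Complex.conj_ofReal]

end ShiftInverse

section SymmetricEigenspaces

universe u v

variable {H : Type u} [NormedAddCommGroup H] [InnerProductSpace ℂ H] {T : H →ₗ.[ℂ] H}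

theorem exists_ofReal_eq_of_eigenspace_ne_bot (hT : T.IsFormalAdjoint T) {m : ℝ}
    (hm : ∀ p ∈ T.graph, m * ‖p.1‖ ^ 2 ≤ (⟪p.1, p.2⟫_ℂ).re) {z : ℂ} (hz : T.eigenspace z ≠ ⊥) :
    ∃ r : ℝ, m ≤ r ∧ (r : ℂ) = z := by
  obtain ⟨x, hx, hx0⟩ := Submodule.exists_mem_ne_zero_of_ne_bot hz
  have hgraph := mem_eigenspace_iff_mem_graph.1 hx
  have hconj := inner_eq_of_mem_graph hT hgraph hgraph
  rw [inner_smul_left, inner_smul_right, mul_left_inj' (inner_self_ne_zero.2 hx0)] at hconj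
  obtain ⟨r, rfl⟩ := Complex.conj_eq_iff_real.1 hconj
  refine ⟨r, le_of_mul_le_mul_right ((hm _ hgraph).trans_eq ?_) (by positivity : 0 < ‖x‖ ^ 2), rfl⟩
  rw [inner_smul_right, Complex.re_ofReal_mul, ← RCLike.re_eq_complex_re, inner_self_eq_norm_sq]

theorem orthogonalFamily_eigenspace (hT : T.IsFormalAdjoint T) :
    OrthogonalFamily ℂ (fun r : ℝ => T.eigenspace r) fun r => (T.eigenspace r).subtypeₗᵢ := by
  intro r s hrs x y
  have h := inner_eq_of_mem_graph hT (mem_eigenspace_iff_mem_graph.1 x.2)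
    (mem_eigenspace_iff_mem_graph.1 y.2)
  rw [inner_smul_left, inner_smul_right, Complex.conj_ofReal] at h
  have hmul : ((r : ℂ) - s) * ⟪(x : H), y⟫_ℂ = 0 := by linear_combination h
  exact (mul_eq_zero.1 hmul).resolve_left (sub_ne_zero.2 (by exact_mod_cast hrs))

theorem exists_mem_graph_re_inner_lt (hT : T.IsFormalAdjoint T) {E : ℝ} {x : H}
    (hx : x ∈ ⨆ r : {r : ℝ // r < E}, T.eigenspace (r : ℝ)) (hx0 : x ≠ 0) :
    ∃ w, (x, w) ∈ T.graph ∧ (⟪x, w⟫_ℂ).re < E * ‖x‖ ^ 2 := by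
  classical
  obtain ⟨f, rfl⟩ := (Submodule.mem_iSup_iff_exists_dfinsupp' _ _).1 hx
  have hV := (orthogonalFamily_eigenspace hT).comp (Subtype.val_injective (p := (· < E)))
  have hsum : ∑ i ∈ f.support, ((f i : H), (((i : ℝ) : ℂ) • f i : H)) ∈ T.graph :=
    Submodule.sum_mem _ fun i _ => mem_eigenspace_iff_mem_graph.1 (f i).2
  have hinner : (⟪∑ i ∈ f.support, (f i : H), ∑ i ∈ f.support, ((i : ℝ) : ℂ) • (f i : H)⟫_ℂ).re =
      ∑ i ∈ f.support, i * ‖f i‖ ^ 2 := by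
    refine (congrArg Complex.re
      (hV.inner_sum f (fun i => ((i : ℝ) : ℂ) • f i) f.support)).trans ?_
    rw [Complex.re_sum]
    refine Finset.sum_congr rfl fun i _ => ?_
    rw [inner_smul_right, Complex.re_ofReal_mul, ← RCLike.re_eq_complex_re, inner_self_eq_norm_sq]
  have hnorm : ‖∑ i ∈ f.support, (f i : H)‖ ^ 2 = ∑ i ∈ f.support, ‖f i‖ ^ 2 :=
    hV.norm_sum f f.support
  refine ⟨∑ i ∈ f.support, ((i : ℝ) : ℂ) • (f i : H), ?_, ?_⟩
  · rwa [← prod_mk_sum] at hsum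
  · have hsupp : f.support.Nonempty := by
      rw [Finset.nonempty_iff_ne_empty, Ne, DFinsupp.support_eq_empty]
      rintro rfl
      exact hx0 DFinsupp.sum_zero_index
    rw [DFinsupp.sum, hinner, hnorm, Finset.mul_sum]
    refine Finset.sum_lt_sum_of_nonempty hsupp fun i hi => ?_
    have hpos : 0 < ‖f i‖ := norm_pos_iff.2 (DFinsupp.mem_support_iff.1 hi)
    have hlt := i.2
    gcongr

/-- `f` is injective on the span of the eigenvectors below `E`, because there the form of `T` is
smaller than `E`. -/
theorem lift_rank_eigenspacesBelow_le (hT : T.IsFormalAdjoint T) {E : ℝ} {V : Type v}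
    [AddCommGroup V] [Module ℂ V] [FiniteDimensional ℂ V] (f : H →ₗ[ℂ] V)
    (hf : ∀ p ∈ T.graph, f p.1 = 0 → E * ‖p.1‖ ^ 2 ≤ (⟪p.1, p.2⟫_ℂ).re) :
    Cardinal.lift.{v} (Module.rank ℂ (T.eigenspacesBelow E)) ≤
      Cardinal.lift.{u} (Module.rank ℂ V) := by
  rw [LinearPMap.eigenspacesBelow]
  set S := ⨆ r : {r : ℝ // r < E}, T.eigenspace (r : ℝ)
  have hinj : Function.Injective (f ∘ₗ S.subtype) := by
    rw [injective_iff_map_eq_zero]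
    intro x hx
    by_contra hx0
    obtain ⟨w, hw, hlt⟩ := exists_mem_graph_re_inner_lt hT x.2 (fun h => hx0 (Subtype.ext h))
    exact hlt.not_ge (hf _ hw hx)
  have hfin : FiniteDimensional ℂ S := Module.Finite.of_injective _ hinj
  rw [S.closed_of_finiteDimensional.submodule_topologicalClosure_eq]
  exact LinearMap.lift_rank_le_of_injective _ hinj

end SymmetricEigenspaces

section HilbertBasisOperators

variable {ι 𝕜 H : Type*} [RCLike 𝕜] [NormedAddCommGroup H] [InnerProductSpace 𝕜 H]
  (e : HilbertBasis ι 𝕜 H)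

theorem hilbertBasis_ext {F : Type*} [NormedAddCommGroup F] [NormedSpace 𝕜 F] {M N : H →L[𝕜] F}
    (h : ∀ i, M (e i) = N (e i)) : M = N :=
  ContinuousLinearMap.ext_on (Submodule.dense_iff_topologicalClosure_eq_top.2 e.dense_span)
    (Set.forall_mem_range.2 h)

theorem denseRange_of_forall_mem_range {E : Type*} [NormedAddCommGroup E] [InnerProductSpace 𝕜 E]
    {D : Type*} [AddCommGroup D] [Module 𝕜 D] {L : D →ₗ[𝕜] E} {U : H →L[𝕜] E}
    (hU : Function.Surjective U) (h : ∀ i, U (e i) ∈ LinearMap.range L) : DenseRange L := by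
  have hspan : Dense (Submodule.span 𝕜 (Set.range e) : Set H) :=
    Submodule.dense_iff_topologicalClosure_eq_top.2 e.dense_span
  have hle : Submodule.span 𝕜 (Set.range e) ≤ (LinearMap.range L).comap (U : H →ₗ[𝕜] E) :=
    Submodule.span_le.2 (Set.range_subset_iff.2 h)
  refine (hU.denseRange.dense_image U.continuous hspan).mono ?_
  exact Set.image_subset_iff.2 hle

variable [CompleteSpace H]

theorem exists_weighted_perm (σ : Equiv.Perm ι) {c : ι → 𝕜} {K : ℝ} (hK : 0 ≤ K)
    (hc : ∀ i, ‖c i‖ ≤ K) : ∃ M : H →L[𝕜] H, ‖M‖ ≤ K ∧ ∀ i, M (e i) = c i • e (σ i) := by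
  classical
  let e' : HilbertBasis ι 𝕜 H := HilbertBasis.mk (e.orthonormal.comp σ σ.injective)
    (by rw [σ.surjective.range_comp e, e.dense_span])
  let D := lp.mapCLM (E := fun _ : ι => 𝕜) (F := fun _ : ι => 𝕜) 2
    (fun i => c i • ContinuousLinearMap.id 𝕜 𝕜) hK (fun i => by simpa [norm_smul] using hc i)
  refine ⟨(e'.repr.symm : _ →L[𝕜] H) ∘L D ∘L (e.repr : H →L[𝕜] _), ?_, fun i => ?_⟩
  · refine ContinuousLinearMap.opNorm_le_bound _ hK fun x => ?_
    have hD : ‖D (e.repr x)‖ ≤ K * ‖e.repr x‖ := D.le_of_opNorm_le (lp.norm_mapCLM_le _ _ hK _) _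
    simpa using hD
  · have hD : D (e.repr (e i)) = c i • lp.single 2 i (1 : 𝕜) := by
      ext j
      by_cases h : j = i <;> simp [D, e.repr_self, h]
    have he' : e'.repr.symm (D (e.repr (e i))) = c i • e (σ i) := by
      rw [hD, map_smul, e'.repr_symm_single, HilbertBasis.coe_mk, Function.comp_apply]
    simpa using he'

theorem exists_isCompactOperator_norm_sub_le {M : H →L[𝕜] H} {c : ι → 𝕜}
    (hM : ∀ i, M (e i) = c i • e i) {K : ℝ} (hK : 0 ≤ K) (hc : {i | K < ‖c i‖}.Finite) :
    ∃ F : H →L[𝕜] H, IsCompactOperator F ∧ ‖M - F‖ ≤ K := by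
  classical
  set s := hc.toFinset with hs
  let F : H →L[𝕜] H := ∑ i ∈ s, c i • (innerSL 𝕜 (e i)).smulRight (e i)
  have hF : IsCompactOperator F := by
    refine (compactOperator (RingHom.id 𝕜) H H).sum_mem fun i _ => Submodule.smul_mem _ _ ?_
    exact (isCompactOperator_of_locallyCompactSpace_dom (innerSL 𝕜 (e i))).clm_comp
      ((1 : 𝕜 →L[𝕜] 𝕜).smulRight (e i))
  obtain ⟨N, hN, hNe⟩ := exists_weighted_perm e (Equiv.refl ι)
    (c := fun i => if i ∈ s then 0 else c i) hK fun i => by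
      split_ifs with h
      · simpa using hK
      · simpa [hs] using h
  refine ⟨F, hF, ?_⟩
  have hMF : M - F = N := by
    refine hilbertBasis_ext e fun i => ?_
    have hFe : F (e i) = if i ∈ s then c i • e i else 0 := by
      simp [F, orthonormal_iff_ite.1 e.orthonormal]
    rw [sub_apply, hM, hFe, hNe]
    split_ifs <;> simp
  rwa [hMF]

theorem isCompactOperator_of_diagonal {M : H →L[𝕜] H} {c : ι → 𝕜}
    (hM : ∀ i, M (e i) = c i • e i) (hc : Filter.Tendsto c Filter.cofinite (nhds 0)) :
    IsCompactOperator M := by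
  suffices h : M ∈ closure {f : H →L[𝕜] H | IsCompactOperator f} by
    rwa [isClosed_setOfPred_isCompactOperator.closure_eq] at h
  rw [Metric.mem_closure_iff]
  intro ε hε
  have hfin : {i | ε / 2 < ‖c i‖}.Finite := by
    have hev := (tendsto_zero_iff_norm_tendsto_zero.1 hc).eventually_le_const (half_pos hε)
    simpa [Filter.eventually_cofinite] using hev
  obtain ⟨F, hF, hMF⟩ := exists_isCompactOperator_norm_sub_le e hM (half_pos hε).le hfin
  exact ⟨F, hF, by rw [dist_eq_norm]; linarith⟩

theorem exists_isCompactOperator_diagonal {c : ι → 𝕜}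
    (hc : Filter.Tendsto c Filter.cofinite (nhds 0)) :
    ∃ S : H →L[𝕜] H, IsCompactOperator S ∧ ∀ i, S (e i) = c i • e i := by
  obtain ⟨K, hK⟩ := hc.norm.bddAbove_range_of_cofinite
  have hcK (i : ι) : ‖c i‖ ≤ max K 0 := (hK ⟨i, rfl⟩).trans (le_max_left _ _)
  obtain ⟨S, -, hS⟩ := exists_weighted_perm e (Equiv.refl ι) (le_max_right K 0) hcK
  exact ⟨S, isCompactOperator_of_diagonal e hS hc, hS⟩

end HilbertBasisOperators

theorem finite_support_inner_of_mem_span {ι 𝕜 H : Type*} [RCLike 𝕜] [NormedAddCommGroup H]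
    [InnerProductSpace 𝕜 H] {v : ι → H} (hv : Orthonormal 𝕜 v) {x : H}
    (hx : x ∈ Submodule.span 𝕜 (Set.range v)) :
    (Function.support fun i => inner 𝕜 (v i) x).Finite := by
  obtain ⟨l, rfl⟩ := Finsupp.mem_span_range_iff_exists_finsupp.1 hx
  refine l.hasFiniteSupport.subset (Function.support_subset_iff'.2 fun i hi => ?_)
  exact (hv.inner_right_finsupp l i).trans (Function.notMem_support.1 hi)

section Jacobi

variable {H : Type*} [NormedAddCommGroup H] [InnerProductSpace ℂ H]
  {T : H →ₗ.[ℂ] H} {e : HilbertBasis ℤ ℂ H} {d p : ℤ → ℝ}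

/-- `T` is the Jacobi operator with diagonal entries `d n` and off-diagonal entries `-p n` with
respect to the basis `e`, with the linear span of the basis as its domain: `p n` couples `e n` and
`e (n + 1)`. -/
structure IsJacobi (T : H →ₗ.[ℂ] H) (e : HilbertBasis ℤ ℂ H) (d p : ℤ → ℝ) : Prop where
  domain_eq : T.domain = Submodule.span ℂ (Set.range e)
  inner_apply : ∀ (x : T.domain) (n : ℤ), ⟪e n, T x⟫_ℂ =
    d n * ⟪e n, (x : H)⟫_ℂ - p n * ⟪e (n + 1), (x : H)⟫_ℂ - p (n - 1) * ⟪e (n - 1), (x : H)⟫_ℂ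

namespace IsJacobi

theorem dense_domain (hT : IsJacobi T e d p) : Dense (T.domain : Set H) := by
  rw [hT.domain_eq]
  exact Submodule.dense_iff_topologicalClosure_eq_top.2 e.dense_span

theorem mem_domain (hT : IsJacobi T e d p) (n : ℤ) : e n ∈ T.domain := by
  rw [hT.domain_eq]
  exact Submodule.subset_span ⟨n, rfl⟩

theorem linearMap_ext (hT : IsJacobi T e d p) {F : Type*} [AddCommGroup F] [Module ℂ F]
    {f g : T.domain →ₗ[ℂ] F}
    (h : ∀ n, f ⟨e n, hT.mem_domain n⟩ = g ⟨e n, hT.mem_domain n⟩) : f = g :=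
  (Submodule.linearMap_eq_iff_of_eq_span f g hT.domain_eq).2 fun ⟨_, n, hn⟩ => by
    subst hn
    exact h n

theorem apply_basis (hT : IsJacobi T e d p) (n : ℤ) :
    T ⟨e n, hT.mem_domain n⟩ =
      (d n : ℂ) • e n - (p n : ℂ) • e (n + 1) - (p (n - 1) : ℂ) • e (n - 1) := by
  refine e.repr.injective (lp.ext (funext fun m => ?_))
  simp only [e.repr_apply_apply, hT.inner_apply, inner_sub_right, inner_smul_right,
    orthonormal_iff_ite.1 e.orthonormal]
  grind

theorem isFormalAdjoint (hT : IsJacobi T e d p) : T.IsFormalAdjoint T := by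
  intro x y
  refine LinearMap.congr_fun (hT.linearMap_ext (f := innerₛₗ ℂ (T x) ∘ₗ T.domain.subtype)
    (g := innerₛₗ ℂ (x : H) ∘ₗ T.toFun) fun n => ?_) y
  change ⟪T x, e n⟫_ℂ = ⟪(x : H), T ⟨e n, hT.mem_domain n⟩⟫_ℂ
  rw [hT.apply_basis, ← inner_conj_symm, hT.inner_apply]
  simp only [map_sub, map_mul, Complex.conj_ofReal, inner_conj_symm, inner_sub_right,
    inner_smul_right]

theorem isClosable [CompleteSpace H] (hT : IsJacobi T e d p) : T.IsClosable :=
  isClosable_of_isFormalAdjoint_self hT.dense_domain hT.isFormalAdjoint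

end IsJacobi

end Jacobi

section Dominance

open Filter Topology

variable {d p : ℤ → ℝ}

/-- The diagonal `d` tends to infinity and, up to finitely many columns, exceeds the sum of the
two off-diagonal entries `p n` and `p (n - 1)` in its column by a fixed factor. -/
structure IsDiagonallyDominant (d p : ℤ → ℝ) : Prop where
  tendsto_atTop : Tendsto d cofinite atTop
  exists_eventually_abs_le : ∃ q < (1 / 2 : ℝ),
    ∀ᶠ n in cofinite, |p n| ≤ q * d n ∧ |p (n - 1)| ≤ q * d n

theorem IsDiagonallyDominant.exists_shift (h : IsDiagonallyDominant d p) :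
    ∃ μ : ℝ, ∃ q < (1 / 2 : ℝ), ∀ n,
      0 < d n + μ ∧ |p n| ≤ q * (d n + μ) ∧ |p (n - 1)| ≤ q * (d n + μ) := by
  obtain ⟨q₀, hq₀, hp⟩ := h.exists_eventually_abs_le
  set q := max q₀ (1 / 4)
  have hq : 0 < q := lt_max_of_lt_right (by norm_num)
  set bad : Set ℤ := {n | ¬ (0 < d n ∧ |p n| ≤ q₀ * d n ∧ |p (n - 1)| ≤ q₀ * d n)}
  have hbad : bad.Finite := (h.tendsto_atTop.eventually_gt_atTop 0).and hp
  have hlarge : ∀ᶠ μ in atTop, ∀ n ∈ bad,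
      0 < d n + μ ∧ |p n| ≤ q * (d n + μ) ∧ |p (n - 1)| ≤ q * (d n + μ) := by
    refine (eventually_all_finite hbad).2 fun n _ => ?_
    have hadd : Tendsto (fun μ => d n + μ) atTop atTop :=
      tendsto_atTop_add_const_left _ _ tendsto_id
    have hmul := hadd.const_mul_atTop hq
    exact (hadd.eventually_gt_atTop 0).and
      ((hmul.eventually_ge_atTop _).and (hmul.eventually_ge_atTop _))
  obtain ⟨μ, hμ, hμ_nonneg⟩ := (hlarge.and (eventually_ge_atTop 0)).exists
  refine ⟨μ, q, max_lt hq₀ (by norm_num), fun n => ?_⟩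
  by_cases hn : n ∈ bad
  · exact hμ n hn
  · obtain ⟨hdn, hpn, hpn'⟩ := not_not.1 hn
    have hle : q₀ * d n ≤ q * (d n + μ) :=
      mul_le_mul (le_max_left _ _) (by linarith) hdn.le hq.le
    exact ⟨by linarith, hpn.trans hle, hpn'.trans hle⟩

theorem isDiagonallyDominant_of_tendsto_div {w : ℤ → ℝ} {δ κ κ' : ℝ}
    (hw : Tendsto w cofinite atTop) (hd : Tendsto (fun n => d n / w n) cofinite (𝓝 δ))
    (hp : Tendsto (fun n => p n / w n) cofinite (𝓝 κ))
    (hp' : Tendsto (fun n => p (n - 1) / w n) cofinite (𝓝 κ'))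
    (hκ : 2 * |κ| < δ) (hκ' : 2 * |κ'| < δ) : IsDiagonallyDominant d p := by
  have hδ : 0 < δ := by linarith [abs_nonneg κ]
  have hwpos : ∀ᶠ n in cofinite, 0 < w n := hw.eventually_gt_atTop 0
  obtain ⟨q, hq, hq2⟩ : ∃ q, max |κ| |κ'| / δ < q ∧ q < 1 / 2 := exists_between <| by
    rw [div_lt_iff₀ hδ, max_lt_iff]
    constructor <;> linarith
  have hbound {r : ℤ → ℝ} {ρ : ℝ} (hr : Tendsto (fun n => r n / w n) cofinite (𝓝 ρ))
      (hρ : |ρ| ≤ max |κ| |κ'|) : ∀ᶠ n in cofinite, |r n| ≤ q * d n := by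
    have hlt : |ρ| < q * δ := hρ.trans_lt ((div_lt_iff₀ hδ).1 hq)
    filter_upwards [hr.abs.eventually_lt (hd.const_mul q) hlt, hwpos] with n hn hwn
    rw [abs_div, abs_of_pos hwn, ← mul_div_assoc] at hn
    exact ((div_lt_div_iff_of_pos_right hwn).1 hn).le
  refine ⟨?_, q, hq2, (hbound hp (le_max_left _ _)).and (hbound hp' (le_max_right _ _))⟩
  refine (hw.atTop_mul_pos hδ hd).congr' ?_
  filter_upwards [hwpos] with n hwn
  exact mul_div_cancel₀ (d n) hwn.ne'

end Dominance

section Neumann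

variable {H : Type*} [NormedAddCommGroup H] [InnerProductSpace ℂ H] [CompleteSpace H]
  {T : H →ₗ.[ℂ] H} {e : HilbertBasis ℤ ℂ H} {d p : ℤ → ℝ}

theorem exists_norm_lt_one_smul_apply_eq (e : HilbertBasis ℤ ℂ H) {q : ℝ} (hq : q < 1 / 2)
    (hdp : ∀ n, 0 < d n ∧ |p n| ≤ q * d n ∧ |p (n - 1)| ≤ q * d n) :
    ∃ W : H →L[ℂ] H, ‖W‖ < 1 ∧
      ∀ n, (d n : ℂ) • W (e n) = (p n : ℂ) • e (n + 1) + (p (n - 1) : ℂ) • e (n - 1) := by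
  have hq_nonneg : 0 ≤ q :=
    nonneg_of_mul_nonneg_left ((abs_nonneg _).trans (hdp 0).2.1) (hdp 0).1
  have hbound {r : ℝ} {n : ℤ} (h : |r| ≤ q * d n) : ‖(r : ℂ) / d n‖ ≤ q := by
    rw [norm_div, Complex.norm_real, Complex.norm_real, Real.norm_eq_abs, Real.norm_eq_abs,
      abs_of_pos (hdp n).1]
    exact (div_le_iff₀ (hdp n).1).2 h
  obtain ⟨W₁, hW₁, hW₁e⟩ := exists_weighted_perm e (Equiv.addRight (1 : ℤ)) hq_nonneg
    fun n => hbound (hdp n).2.1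
  obtain ⟨W₂, hW₂, hW₂e⟩ := exists_weighted_perm e (Equiv.subRight (1 : ℤ)) hq_nonneg
    fun n => hbound (hdp n).2.2
  refine ⟨W₁ + W₂, (norm_add_le _ _).trans_lt (by linarith), fun n => ?_⟩
  have hdn : (d n : ℂ) ≠ 0 := Complex.ofReal_ne_zero.2 (hdp n).1.ne'
  rw [add_apply, hW₁e, hW₂e, smul_add, smul_smul, smul_smul, mul_div_cancel₀ _ hdn,
    mul_div_cancel₀ _ hdn, Equiv.coe_addRight, Equiv.subRight_apply]

namespace IsJacobi

/-- On the basis `T + μ = (1 - W) D` with `D` diagonal and `‖W‖ < 1`, so the inverse is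
`D⁻¹ (1 - W)⁻¹`. -/
theorem exists_isCompactOperator_leftInverse (hT : IsJacobi T e d p)
    (hdp : IsDiagonallyDominant d p) :
    ∃ (μ : ℝ) (R : H →L[ℂ] H), IsCompactOperator R ∧
      (∀ x : T.domain, R (T x + (μ : ℂ) • (x : H)) = x) ∧
      DenseRange fun x : T.domain => T x + (μ : ℂ) • (x : H) := by
  obtain ⟨μ, q, hq, hμ⟩ := hdp.exists_shift
  obtain ⟨W, hW, hWe⟩ := exists_norm_lt_one_smul_apply_eq e (d := fun n => d n + μ) hq hμ
  obtain ⟨V, hV, hV'⟩ := isUnit_iff_exists.1 (isUnit_one_sub_of_norm_lt_one hW)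
  have hlim : Filter.Tendsto (fun n => (((d n + μ)⁻¹ : ℝ) : ℂ)) Filter.cofinite (nhds 0) :=
    (Complex.continuous_ofReal.tendsto' 0 0 Complex.ofReal_zero).comp
      (Filter.tendsto_atTop_add_const_right _ μ hdp.tendsto_atTop).inv_tendsto_atTop
  obtain ⟨S, hS, hSe⟩ := exists_isCompactOperator_diagonal e hlim
  let L : T.domain →ₗ[ℂ] H := T.toFun + (μ : ℂ) • T.domain.subtype
  have hne (n : ℤ) : ((d n + μ : ℝ) : ℂ) ≠ 0 := Complex.ofReal_ne_zero.2 (hμ n).1.ne'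
  have hLe (n : ℤ) : L ⟨e n, hT.mem_domain n⟩ = ((d n + μ : ℝ) : ℂ) • (1 - W) (e n) := by
    rw [sub_apply, smul_sub, hWe]
    refine (congrArg (· + (μ : ℂ) • e n) (hT.apply_basis n)).trans ?_
    rw [one_apply_eq_self]
    push_cast
    module
  have hVe (n : ℤ) : V ((1 - W) (e n)) = e n := congr($hV' (e n))
  refine ⟨μ, S * V, hS.comp_clm V, fun x => ?_, ?_⟩
  · refine LinearMap.congr_fun (hT.linearMap_ext (f := ((S * V : H →L[ℂ] H) : H →ₗ[ℂ] H) ∘ₗ L)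
      (g := T.domain.subtype) fun n => ?_) x
    rw [LinearMap.comp_apply, hLe, map_smul]
    change _ • S (V ((1 - W) (e n))) = e n
    rw [hVe, hSe, smul_smul, Complex.ofReal_inv, mul_inv_cancel₀ (hne n), one_smul]
  · refine denseRange_of_forall_mem_range e (L := L) (U := 1 - W)
      (fun y => ⟨V y, congr($hV y)⟩) fun n => ?_
    rw [← Submodule.smul_mem_iff _ (hne n), ← hLe]
    exact LinearMap.mem_range_self L _

theorem exists_isShiftInverse_closure (hT : IsJacobi T e d p) (hdp : IsDiagonallyDominant d p) :
    ∃ (μ : ℝ) (R : H →L[ℂ] H), IsCompactOperator R ∧ (R : H →ₗ[ℂ] H).IsSymmetric ∧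
      IsShiftInverse T.closure μ R := by
  obtain ⟨μ, R, hR, hRT, hr⟩ := hT.exists_isCompactOperator_leftInverse hdp
  exact ⟨μ, R, hR, isSymmetric_of_isFormalAdjoint hT.isFormalAdjoint hRT hr,
    isShiftInverse_closure hT.isClosable hRT hr⟩

theorem isEssentiallySelfAdjoint (hT : IsJacobi T e d p) (hdp : IsDiagonallyDominant d p) :
    T.IsEssentiallySelfAdjoint := by
  obtain ⟨μ, R, -, hRs, hTR⟩ := hT.exists_isShiftInverse_closure hdp
  exact ⟨hT.dense_domain, hT.isFormalAdjoint,
    hTR.isSelfAdjoint hRs (hT.dense_domain.mono T.le_closure.1)⟩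

theorem closure_hasPurelyDiscreteSpectrum (hT : IsJacobi T e d p)
    (hdp : IsDiagonallyDominant d p) : T.closure.HasPurelyDiscreteSpectrum := by
  obtain ⟨μ, R, hR, hRs, hTR⟩ := hT.exists_isShiftInverse_closure hdp
  exact hTR.hasPurelyDiscreteSpectrum hR hRs

end IsJacobi

end Neumann

theorem hasSum_add_of_hasSum_add_shift {f g : ℤ → ℝ} {s : ℝ} (hg : Summable g)
    (h : HasSum (fun n => f n + g (n - 1)) s) : HasSum (fun n => f n + g n) s := by
  have hshift : HasSum (fun n => g (n - 1)) (∑' n, g n) :=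
    (Equiv.hasSum_iff (Equiv.subRight (1 : ℤ))).2 hg.hasSum
  simpa using (h.sub hshift).add hg.hasSum

theorem hasSum_norm_inner_sq {ι 𝕜 H : Type*} [RCLike 𝕜] [NormedAddCommGroup H]
    [InnerProductSpace 𝕜 H] (e : HilbertBasis ι 𝕜 H) (x : H) :
    HasSum (fun i => ‖inner 𝕜 (e i) x‖ ^ 2) (‖x‖ ^ 2) := by
  have h := RCLike.hasSum_re 𝕜 (e.hasSum_inner_mul_inner x x)
  rw [inner_self_eq_norm_sq] at h
  refine h.congr_fun fun i => ?_
  rw [← inner_conj_symm x, RCLike.conj_mul]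
  norm_cast

/-- The diagonal of the Jacobi matrix of `b ∇* a ∇ b + w`, where `∇` is the forward difference
on `ℤ` and `a n` sits on the edge from `n` to `n + 1`. -/
def divergenceDiag (a b w : ℤ → ℝ) (n : ℤ) : ℝ :=
  b n ^ 2 * (a n + a (n - 1)) + w n

/-- The off-diagonal of the Jacobi matrix of `b ∇* a ∇ b + w`, with the sign convention of
`IsJacobi`. -/
def divergenceOffDiag (a b : ℤ → ℝ) (n : ℤ) : ℝ :=
  a n * b n * b (n + 1)

section DivergenceForm

open Filter Topology

theorem isDiagonallyDominant_divergence {a b w u : ℤ → ℝ} {κ l : ℝ}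
    (hu : Tendsto u cofinite atTop) (hw : Tendsto (fun n => w n / u n) cofinite (𝓝 l))
    (ha : Tendsto (fun n => b n ^ 2 * a n / u n) cofinite (𝓝 κ))
    (ha' : Tendsto (fun n => b n ^ 2 * a (n - 1) / u n) cofinite (𝓝 κ))
    (hb : Tendsto (fun n => b (n + 1) / b n) cofinite (𝓝 1)) (hκ : 2 * |κ| < 2 * κ + l) :
    IsDiagonallyDominant (divergenceDiag a b w) (divergenceOffDiag a b) := by
  have hb_ne : ∀ᶠ n in cofinite, b n ≠ 0 :=
    (hb.eventually_ne one_ne_zero).mono fun n hn => (div_ne_zero_iff.1 hn).2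
  have hb' : Tendsto (fun n => b (n - 1) / b n) cofinite (𝓝 1) := by
    simpa using (hb.comp (sub_left_injective (b := (1 : ℤ))).tendsto_cofinite).inv₀ one_ne_zero
  refine isDiagonallyDominant_of_tendsto_div (δ := 2 * κ + l) hu ?_ ?_ ?_ hκ hκ
  · rw [two_mul]
    refine ((ha.add ha').add hw).congr fun n => ?_
    rw [divergenceDiag, mul_add, add_div, add_div]
  · refine (mul_one κ ▸ ha.mul hb).congr' (hb_ne.mono fun n hn => ?_)
    simp only [divergenceOffDiag]
    field_simp
  · refine (mul_one κ ▸ ha'.mul hb').congr' (hb_ne.mono fun n hn => ?_)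
    simp only [divergenceOffDiag, sub_add_cancel]
    field_simp

namespace IsJacobi

variable {H : Type*} [NormedAddCommGroup H] [InnerProductSpace ℂ H]
  {T : H →ₗ.[ℂ] H} {e : HilbertBasis ℤ ℂ H} {a b w : ℤ → ℝ}

theorem hasSum_re_inner_apply
    (hT : IsJacobi T e (divergenceDiag a b w) (divergenceOffDiag a b)) (x : T.domain) :
    HasSum (fun n => a n * ‖b n * ⟪e n, (x : H)⟫_ℂ - b (n + 1) * ⟪e (n + 1), (x : H)⟫_ℂ‖ ^ 2
      + w n * ‖⟪e n, (x : H)⟫_ℂ‖ ^ 2) (⟪(x : H), T x⟫_ℂ).re := by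
  have hsq (z : ℂ) : ‖z‖ ^ 2 = (starRingEnd ℂ z * z).re := by
    rw [Complex.conj_mul']
    norm_cast
  set c : ℤ → ℂ := fun n => ⟪e n, (x : H)⟫_ℂ
  set u : ℤ → ℂ := fun n => b n * c n
  set f : ℤ → ℝ := fun n =>
    w n * ‖c n‖ ^ 2 + a n * (starRingEnd ℂ (u n) * (u n - u (n + 1))).re with hf
  set g : ℤ → ℝ := fun n => a n * (starRingEnd ℂ (u (n + 1)) * (u (n + 1) - u n)).re with hg
  have hsummable : Summable g := by
    have hfin : (Function.support c).Finite :=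
      finite_support_inner_of_mem_span e.orthonormal (hT.domain_eq ▸ x.2)
    refine summable_of_hasFiniteSupport <|
      (hfin.preimage (add_left_injective (1 : ℤ)).injOn).subset <|
        Function.support_subset_iff'.2 fun n hn => ?_
    have hn : c (n + 1) = 0 := Function.notMem_support.1 hn
    simp only [hg, u, hn, mul_zero, map_zero, zero_mul, Complex.zero_re]
  have hsum : HasSum (fun n => f n + g (n - 1)) (⟪(x : H), T x⟫_ℂ).re := by
    refine (Complex.hasSum_re (e.hasSum_inner_mul_inner (x : H) (T x))).congr_fun fun n => ?_
    have hterm : ⟪(x : H), e n⟫_ℂ * ⟪e n, T x⟫_ℂ = w n * (starRingEnd ℂ (c n) * c n)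
        + a n * (starRingEnd ℂ (u n) * (u n - u (n + 1)))
        + a (n - 1) * (starRingEnd ℂ (u n) * (u n - u (n - 1))) := by
      rw [← inner_conj_symm, hT.inner_apply]
      simp only [divergenceDiag, divergenceOffDiag, sub_add_cancel, u, c, map_mul,
        Complex.conj_ofReal]
      push_cast
      ring
    simp only [hterm, hf, hg, hsq, Complex.add_re, Complex.re_ofReal_mul, sub_add_cancel]
  refine (hasSum_add_of_hasSum_add_shift hsummable hsum).congr_fun fun n => ?_
  change a n * ‖u n - u (n + 1)‖ ^ 2 + w n * ‖c n‖ ^ 2 = _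
  simp only [hf, hg, hsq (u n - u (n + 1)), map_sub, mul_sub, sub_mul, Complex.sub_re]
  ring

theorem le_re_inner_add_sum (hT : IsJacobi T e (divergenceDiag a b w) (divergenceOffDiag a b))
    (ha : ∀ n, 0 ≤ a n) {E : ℝ} {F : Finset ℤ} (hF : ∀ n ∉ F, E ≤ w n) (x : T.domain) :
    E * ‖(x : H)‖ ^ 2 ≤
      (⟪(x : H), T x⟫_ℂ).re + ∑ n ∈ F, (E - w n) * ‖⟪e n, (x : H)⟫_ℂ‖ ^ 2 := by
  have hsum := (hT.hasSum_re_inner_apply x).sub ((hasSum_norm_inner_sq e (x : H)).mul_left E)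
  have hgrad (n : ℤ) : 0 ≤
      a n * ‖b n * ⟪e n, (x : H)⟫_ℂ - b (n + 1) * ⟪e (n + 1), (x : H)⟫_ℂ‖ ^ 2 :=
    mul_nonneg (ha n) (sq_nonneg _)
  have hle := sum_le_hasSum F (fun n hn => by
    linarith [hgrad n, mul_le_mul_of_nonneg_right (hF n hn) (sq_nonneg ‖⟪e n, (x : H)⟫_ℂ‖)]) hsum
  have hterms := Finset.sum_nonneg fun n (_ : n ∈ F) => hgrad n
  simp only [Finset.sum_sub_distrib, Finset.sum_add_distrib, sub_mul] at hle ⊢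
  linarith

variable [CompleteSpace H]

theorem le_re_inner_of_mem_graph_closure
    (hT : IsJacobi T e (divergenceDiag a b w) (divergenceOffDiag a b)) (ha : ∀ n, 0 ≤ a n)
    {E : ℝ} {F : Finset ℤ} (hF : ∀ n ∉ F, E ≤ w n) {p : H × H} (hp : p ∈ T.closure.graph)
    (hpF : ∀ n ∈ F, ⟪e n, p.1⟫_ℂ = 0) : E * ‖p.1‖ ^ 2 ≤ (⟪p.1, p.2⟫_ℂ).re := by
  have h := le_re_inner_add_of_mem_graph_closure hT.isClosable
    (φ := fun x => ∑ n ∈ F, (E - w n) * ‖⟪e n, x⟫_ℂ‖ ^ 2) (by fun_prop)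
    (hT.le_re_inner_add_sum ha hF) hp
  rwa [Finset.sum_eq_zero fun n hn => by
    rw [hpF n hn, norm_zero, zero_pow two_ne_zero, mul_zero], add_zero] at h

theorem closure_spectrum_subset
    (hT : IsJacobi T e (divergenceDiag a b w) (divergenceOffDiag a b))
    (hdom : IsDiagonallyDominant (divergenceDiag a b w) (divergenceOffDiag a b))
    (ha : ∀ n, 0 ≤ a n) (hw_pos : ∀ n, 0 < w n) (hw : Tendsto w cofinite atTop) :
    T.closure.spectrum ⊆ (fun r : ℝ => (r : ℂ)) '' Set.Ioi 0 := by
  obtain ⟨n₀, hn₀⟩ : ∃ n₀, ∀ n, w n₀ ≤ w n := hw.exists_forall_le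
  intro z hz
  obtain ⟨r, hr, rfl⟩ := exists_ofReal_eq_of_eigenspace_ne_bot
    (isFormalAdjoint_closure hT.isClosable hT.isFormalAdjoint)
    (fun p hp => hT.le_re_inner_of_mem_graph_closure ha (F := ∅) (fun n _ => hn₀ n) hp (by simp))
    (hT.closure_hasPurelyDiscreteSpectrum hdom z hz).2.1
  exact ⟨r, (hw_pos n₀).trans_le hr, rfl⟩

theorem rank_eigenspacesBelow_closure_le {H : Type u} [NormedAddCommGroup H]
    [InnerProductSpace ℂ H] [CompleteSpace H] {T : H →ₗ.[ℂ] H} {e : HilbertBasis ℤ ℂ H}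
    (hT : IsJacobi T e (divergenceDiag a b w) (divergenceOffDiag a b))
    (ha : ∀ n, 0 ≤ a n) (hw : Tendsto w cofinite atTop) (E : ℝ) :
    Module.rank ℂ (T.closure.eigenspacesBelow E) ≤
      Cardinal.lift.{u} (Cardinal.mk {n : ℤ // w n < E}) := by
  have hfin : {n | w n < E}.Finite :=
    (eventually_cofinite.1 (hw.eventually_ge_atTop E)).subset fun n hn => not_le.2 hn
  have : Fintype {n : ℤ // w n < E} := hfin.fintype
  have h := lift_rank_eigenspacesBelow_le
    (isFormalAdjoint_closure hT.isClosable hT.isFormalAdjoint) (E := E)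
    (LinearMap.pi fun n : {n : ℤ // w n < E} => innerₛₗ ℂ (e n)) fun p hp h0 =>
      hT.le_re_inner_of_mem_graph_closure ha (F := hfin.toFinset) (by simp) hp
        fun n hn => congrFun h0 ⟨n, hfin.mem_toFinset.1 hn⟩
  rwa [rank_fun', ← Cardinal.mk_fintype, Cardinal.lift_id'] at h

end IsJacobi

end DivergenceForm

namespace LQC

open Filter Topology

theorem orthonormal_ket : Orthonormal ℂ ket := by
  rw [orthonormal_iff_ite]
  intro v w
  rw [ket, lp.inner_single_left, ket_apply, RCLike.inner_apply, map_one, mul_one]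

/-- The basis vector `|4n + ε⟩` as an element of `Heps ε`. -/
noncomputable def latticeKet (ε : ℝ) (n : ℤ) : Heps ε :=
  ⟨ket (4 * n + ε), (Deps ε).le_topologicalClosure (Submodule.subset_span ⟨n, rfl⟩)⟩

theorem orthonormal_latticeKet (ε : ℝ) : Orthonormal ℂ (latticeKet ε) := by
  have hinj : Function.Injective fun n : ℤ => 4 * (n : ℝ) + ε := fun m n h => by
    simpa using h
  exact (orthonormal_ket.comp _ hinj).codRestrict _ _

theorem span_latticeKet (ε : ℝ) :
    Submodule.span ℂ (Set.range (latticeKet ε)) = (Deps ε).comap (Heps ε).subtype := by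
  apply Submodule.map_injective_of_injective (Heps ε).injective_subtype
  rw [Submodule.map_span, ← Set.range_comp, Submodule.map_comap_subtype,
    inf_eq_right.2 (Deps ε).le_topologicalClosure]
  rfl

theorem dense_span_latticeKet (ε : ℝ) :
    ⊤ ≤ (Submodule.span ℂ (Set.range (latticeKet ε))).topologicalClosure := by
  rw [span_latticeKet]
  rintro ⟨x, hx⟩ -
  refine closure_subtype.2 ?_
  have himage : Subtype.val '' ((Deps ε).comap (Heps ε).subtype : Set (Heps ε)) = Deps ε :=
    (Subtype.image_preimage_coe _ _).trans
      (Set.inter_eq_right.2 (Deps ε).le_topologicalClosure)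
  exact himage ▸ hx

/-- The Hilbert basis `|4n + ε⟩`, `n : ℤ`, of `Heps ε`. -/
noncomputable def latticeBasis (ε : ℝ) : HilbertBasis ℤ ℂ (Heps ε) :=
  HilbertBasis.mk (orthonormal_latticeKet ε) (dense_span_latticeKet ε)

theorem coe_latticeBasis (ε : ℝ) : ⇑(latticeBasis ε) = latticeKet ε :=
  HilbertBasis.coe_mk _ _

theorem inner_latticeBasis (ε : ℝ) (n : ℤ) (x : Heps ε) :
    ⟪latticeBasis ε n, x⟫_ℂ = (x : Hgr) (4 * n + ε) := by
  rw [coe_latticeBasis, Submodule.coe_inner]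
  change ⟪lp.single 2 (4 * n + ε : ℝ) 1, (x : Hgr)⟫_ℂ = _
  rw [lp.inner_single_left, RCLike.inner_apply, map_one, mul_one]

theorem formalHAPS_apply (A B : ℝ → ℝ) (Λ : ℝ) (ψ : ℝ → ℂ) (v : ℝ) :
    formalHAPS A B Λ ψ v = (√(B v))⁻¹ * ((A (v + 2) + A (v - 2) + Λ * |v|) * ((√(B v))⁻¹ * ψ v)
      - A (v + 2) * ((√(B (v + 4)))⁻¹ * ψ (v + 4))
      - A (v - 2) * ((√(B (v - 4)))⁻¹ * ψ (v - 4))) := by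
  have hadd : v + 2 + 2 = v + 4 := by ring
  have hsub : v - 2 - 2 = v - 4 := by ring
  simp only [formalHAPS, mulOp, holonomy, LinearMap.comp_apply, LinearMap.add_apply,
    LinearMap.sub_apply, LinearMap.neg_apply, LinearMap.coe_mk, AddHom.coe_mk, Pi.add_apply,
    Pi.sub_apply, Pi.neg_apply, sub_neg_eq_add, hadd, hsub]
  push_cast
  ring

/-- The weight of the edge between `4n + ε` and `4(n + 1) + ε`. -/
noncomputable def edgeWeight (A : ℝ → ℝ) (ε : ℝ) (n : ℤ) : ℝ := A (4 * n + ε + 2)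

/-- The factor `B(v)^(-1/2)` at the lattice point `v = 4n + ε`. -/
noncomputable def vertexWeight (B : ℝ → ℝ) (ε : ℝ) (n : ℤ) : ℝ := (√(B (4 * n + ε)))⁻¹

/-- The function `|v| / B(v)` at the lattice point `v = 4n + ε`. -/
noncomputable def potential (B : ℝ → ℝ) (ε : ℝ) (n : ℤ) : ℝ := |4 * n + ε| / B (4 * n + ε)

variable {A B : ℝ → ℝ} {Λ ε : ℝ}

theorem isJacobi_HAPS (hB : ∀ n : ℤ, 0 < B (4 * n + ε)) :
    IsJacobi (HAPS A B Λ ε) (latticeBasis ε)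
      (divergenceDiag (edgeWeight A ε) (vertexWeight B ε) fun n => Λ * potential B ε n)
      (divergenceOffDiag (edgeWeight A ε) (vertexWeight B ε)) where
  domain_eq := by
    rw [coe_latticeBasis, span_latticeKet]
    rfl
  inner_apply x n := by
    simp only [inner_latticeBasis]
    have h_apply : (HAPS A B Λ ε x : Hgr) (4 * n + ε) =
      formalHAPS A B Λ ((x : Heps ε) : Hgr) (4 * n + ε) := rfl
    have h_succ : 4 * ((n + 1 : ℤ) : ℝ) + ε = 4 * n + ε + 4 := by push_cast; ring
    have h_pred : 4 * ((n - 1 : ℤ) : ℝ) + ε = 4 * n + ε - 4 := by push_cast; ring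
    have h_mid : 4 * (n : ℝ) + ε - 4 + 2 = 4 * n + ε - 2 := by ring
    have h_sqrt : (√(B (4 * n + ε)))⁻¹ ^ 2 = (B (4 * n + ε))⁻¹ := by
      rw [inv_pow, Real.sq_sqrt (hB n).le]
    rw [h_apply, formalHAPS_apply]
    simp only [divergenceDiag, divergenceOffDiag, edgeWeight, vertexWeight, potential,
      sub_add_cancel, h_succ, h_pred, h_mid, div_eq_mul_inv, ← h_sqrt]
    push_cast
    ring

theorem tendsto_abs_add_div_abs (k : ℝ) :
    Tendsto (fun v : ℝ => |v + k| / |v|) (cocompact ℝ) (𝓝 1) := by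
  have habs : Tendsto (fun v : ℝ => |v|) (cocompact ℝ) atTop := tendsto_norm_cocompact_atTop
  have hsmall : Tendsto (fun v : ℝ => |k| / |v|) (cocompact ℝ) (𝓝 0) := habs.const_div_atTop _
  rw [tendsto_iff_norm_sub_tendsto_zero]
  refine squeeze_zero' (Eventually.of_forall fun _ => norm_nonneg _) ?_ hsmall
  filter_upwards [habs.eventually_gt_atTop 0] with v hv
  rw [Real.norm_eq_abs, div_sub_one hv.ne', abs_div, abs_abs]
  refine div_le_div_of_nonneg_right ?_ (abs_nonneg v)
  simpa using abs_abs_sub_abs_le_abs_sub (v + k) v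

theorem tendsto_lattice_cocompact (ε : ℝ) :
    Tendsto (fun n : ℤ => 4 * (n : ℝ) + ε) cofinite (cocompact ℝ) :=
  (((Homeomorph.mulLeft₀ (4 : ℝ) four_ne_zero).trans
    (Homeomorph.addRight ε)).isClosedEmbedding.tendsto_cocompact).comp Int.tendsto_coe_cofinite

theorem isDiagonallyDominant_HAPS {c : ℝ} (hc : 2 * |c| < 2 * c + Λ)
    (hA : Tendsto (fun n => edgeWeight A ε n / |4 * n + ε|) cofinite (𝓝 c))
    (hB : Tendsto (fun n : ℤ => B (4 * n + ε + 4) / B (4 * n + ε)) cofinite (𝓝 1))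
    (hBv : Tendsto (potential B ε) cofinite atTop) (hBpos : ∀ n : ℤ, 0 < B (4 * n + ε)) :
    IsDiagonallyDominant
      (divergenceDiag (edgeWeight A ε) (vertexWeight B ε) fun n => Λ * potential B ε n)
      (divergenceOffDiag (edgeWeight A ε) (vertexWeight B ε)) := by
  have h_sq (n : ℤ) (t : ℝ) :
      vertexWeight B ε n ^ 2 * t / potential B ε n = t / |4 * n + ε| := by
    rw [vertexWeight, potential, inv_pow, Real.sq_sqrt (hBpos n).le]
    field [(hBpos n).ne']
  have hA' : Tendsto (fun n => edgeWeight A ε (n - 1) / |4 * n + ε|) cofinite (𝓝 c) := by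
    have hratio := (tendsto_abs_add_div_abs (-4)).comp (tendsto_lattice_cocompact ε)
    have h := (hA.comp (sub_left_injective (b := (1 : ℤ))).tendsto_cofinite).mul hratio
    rw [mul_one] at h
    refine h.congr' ((hratio.eventually_ne one_ne_zero).mono fun n hn => ?_)
    have h_pred : 4 * ((n - 1 : ℤ) : ℝ) + ε = 4 * n + ε + -4 := by push_cast; ring
    simp only [Function.comp_apply, h_pred] at hn ⊢
    exact div_mul_div_cancel₀ (div_ne_zero_iff.1 hn).1
  have hb : Tendsto (fun n => vertexWeight B ε (n + 1) / vertexWeight B ε n) cofinite (𝓝 1) := by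
    have h := hB.sqrt.inv₀ (by simp)
    rw [Real.sqrt_one, inv_one] at h
    refine h.congr fun n => ?_
    have h_succ : 4 * ((n + 1 : ℤ) : ℝ) + ε = 4 * n + ε + 4 := by push_cast; ring
    rw [vertexWeight, vertexWeight, h_succ, Real.sqrt_div' _ (hBpos n).le, inv_div, inv_div_inv]
  refine isDiagonallyDominant_divergence hBv (l := Λ) ?_ ?_ ?_ hb hc
  · refine tendsto_const_nhds.congr' ((hBv.eventually_ne_atTop 0).mono fun n hn => ?_)
    exact (mul_div_cancel_right₀ _ hn).symm
  · simpa only [h_sq] using hA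
  · simpa only [h_sq] using hA'

theorem tendsto_div_abs_of_hasCompactSupport_sub {c : ℝ}
    (hA : HasCompactSupport fun v : ℝ => A v - c * |v|) (k : ℝ) :
    Tendsto (fun v : ℝ => A (v + k) / |v|) (cocompact ℝ) (𝓝 c) := by
  have hshift : Tendsto (fun v : ℝ => v + k) (cocompact ℝ) (cocompact ℝ) :=
    (Homeomorph.addRight k).isClosedEmbedding.tendsto_cocompact
  rw [hasCompactSupport_iff_eventuallyEq, coclosedCompact_eq_cocompact] at hA
  refine (mul_one c ▸ (tendsto_abs_add_div_abs k).const_mul c).congr' ?_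
  filter_upwards [hshift.eventually hA] with v hv
  rw [sub_eq_zero.1 hv, mul_div_assoc]

theorem tendsto_abs_mul_of_isBigO {α : ℝ}
    (hB : (fun v : ℝ => |v| * B v - (1 + α / |v| ^ 2)) =O[cocompact ℝ] fun v => 1 / v ^ 4) :
    Tendsto (fun v : ℝ => |v| * B v) (cocompact ℝ) (𝓝 1) := by
  have habs : Tendsto (fun v : ℝ => |v|) (cocompact ℝ) atTop := tendsto_norm_cocompact_atTop
  have hquartic : Tendsto (fun v : ℝ => 1 / v ^ 4) (cocompact ℝ) (𝓝 0) := by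
    refine (((tendsto_pow_atTop four_ne_zero).comp habs).const_div_atTop 1).congr fun v => ?_
    rw [Function.comp_apply, Even.pow_abs (by decide)]
  have hsq : Tendsto (fun v : ℝ => α / |v| ^ 2) (cocompact ℝ) (𝓝 0) :=
    ((tendsto_pow_atTop two_ne_zero).comp habs).const_div_atTop α
  simpa using (hB.trans_tendsto hquartic).add (hsq.const_add 1)

theorem tendsto_add_div_of_tendsto_abs_mul
    (hB : Tendsto (fun v : ℝ => |v| * B v) (cocompact ℝ) (𝓝 1)) (k : ℝ) :
    Tendsto (fun v : ℝ => B (v + k) / B v) (cocompact ℝ) (𝓝 1) := by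
  have hshift : Tendsto (fun v : ℝ => v + k) (cocompact ℝ) (cocompact ℝ) :=
    (Homeomorph.addRight k).isClosedEmbedding.tendsto_cocompact
  have h := ((hB.comp hshift).div hB one_ne_zero).div (tendsto_abs_add_div_abs k) one_ne_zero
  rw [div_one, div_one] at h
  refine h.congr' ?_
  filter_upwards [hB.eventually_ne one_ne_zero, (hB.comp hshift).eventually_ne one_ne_zero]
    with v hv hv'
  have hv_ne : |v| ≠ 0 := left_ne_zero_of_mul hv
  have hv'_ne : |v + k| ≠ 0 := left_ne_zero_of_mul hv'
  simp only [Pi.div_apply, Function.comp_apply]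
  field_simp

theorem tendsto_abs_div_of_tendsto_abs_mul
    (hB : Tendsto (fun v : ℝ => |v| * B v) (cocompact ℝ) (𝓝 1)) :
    Tendsto (fun v : ℝ => |v| / B v) (cocompact ℝ) atTop := by
  have habs : Tendsto (fun v : ℝ => |v|) (cocompact ℝ) atTop := tendsto_norm_cocompact_atTop
  have h := ((tendsto_pow_atTop two_ne_zero).comp habs).atTop_mul_pos one_pos
    (inv_one (G := ℝ) ▸ hB.inv₀ one_ne_zero)
  refine h.congr' ?_
  filter_upwards [habs.eventually_ne_atTop 0] with v hv
  simp only [Function.comp_apply]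
  field_simp

end LQC

theorem theorem1_general (Λ ε c : ℝ) (A B : ℝ → ℝ) (hc : 2 * |c| < 2 * c + Λ)
    (hε : ∀ n : ℤ, 4 * (n : ℝ) + ε ≠ 0)
    (hA : Filter.Tendsto (fun n : ℤ => A (4 * n + ε + 2) / |4 * n + ε|) Filter.cofinite (nhds c))
    (hB : Filter.Tendsto (fun n : ℤ => B (4 * n + ε + 4) / B (4 * n + ε)) Filter.cofinite (nhds 1))
    (hBv : Filter.Tendsto (fun n : ℤ => |4 * n + ε| / B (4 * n + ε)) Filter.cofinite Filter.atTop)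
    (hBpos : ∀ n : ℤ, 0 < B (4 * n + ε)) :
    (LQC.HAPS A B Λ ε).IsEssentiallySelfAdjoint ∧
    (LQC.HAPS A B Λ ε).closure.HasPurelyDiscreteSpectrum ∧
    ((∀ n : ℤ, 0 ≤ A (4 * n + ε + 2)) →
      (LQC.HAPS A B Λ ε).closure.spectrum ⊆ (fun r : ℝ => (r : ℂ)) '' Set.Ioi 0 ∧
      ∀ E : ℝ, Module.rank ℂ ((LQC.HAPS A B Λ ε).closure.eigenspacesBelow E) ≤
        Cardinal.mk {n : ℤ // Λ * (|4 * (n : ℝ) + ε| / B (4 * n + ε)) < E}) := by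
  have hJ := LQC.isJacobi_HAPS (A := A) (Λ := Λ) hBpos
  have hdom := LQC.isDiagonallyDominant_HAPS hc hA hB hBv hBpos
  refine ⟨hJ.isEssentiallySelfAdjoint hdom, hJ.closure_hasPurelyDiscreteSpectrum hdom,
    fun hA_nonneg => ?_⟩
  have hΛ : 0 < Λ := by linarith [le_abs_self c]
  have hw := hBv.const_mul_atTop hΛ
  have hw_pos (n : ℤ) : 0 < Λ * (|4 * (n : ℝ) + ε| / B (4 * n + ε)) :=
    mul_pos hΛ (div_pos (abs_pos.2 (hε n)) (hBpos n))
  refine ⟨hJ.closure_spectrum_subset hdom hA_nonneg hw_pos hw, fun E => ?_⟩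
  exact (hJ.rank_eigenspacesBelow_closure_le hA_nonneg hw E).trans_eq (Cardinal.lift_id _)

theorem theorem1 (G Λ α ε : ℝ) (A B : ℝ → ℝ) (hG : 0 < G) (hΛ : 0 < Λ)
    -- the lattice `4ℤ + ε` does not contain `0` (in particular, any `ε ∈ (0, 4)`)
    (hε : ∀ n : ℤ, 4 * (n : ℝ) + ε ≠ 0)
    -- `A v = (3/4) π G |v|` up to a function of compact support
    (hA : HasCompactSupport fun v : ℝ => A v - 3 / 4 * Real.pi * G * |v|)
    -- `B v = (1/|v|) (1 + α/|v|² + O(1/v⁴))` as `|v| → ∞`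
    (hB : (fun v : ℝ => |v| * B v - (1 + α / |v| ^ 2)) =O[Filter.cocompact ℝ]
      fun v : ℝ => 1 / v ^ 4)
    -- `B` is positive on the lattice, so that `B(v̂)^(-1/2)` makes sense
    (hBpos : ∀ n : ℤ, 0 < B (4 * n + ε)) :
    (LQC.HAPS A B Λ ε).IsEssentiallySelfAdjoint ∧
    (LQC.HAPS A B Λ ε).closure.HasPurelyDiscreteSpectrum ∧
    -- non-negativity of `A` at the points where it enters the operator
    ((∀ n : ℤ, 0 ≤ A (4 * n + ε + 2)) →
      (LQC.HAPS A B Λ ε).closure.spectrum ⊆ (fun r : ℝ => (r : ℂ)) '' Set.Ioi 0 ∧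
      ∀ E : ℝ, Module.rank ℂ ((LQC.HAPS A B Λ ε).closure.eigenspacesBelow E) ≤
        Cardinal.mk {n : ℤ // Λ * (|4 * (n : ℝ) + ε| / B (4 * n + ε)) < E}) := by
  have hv := LQC.tendsto_lattice_cocompact ε
  have hB' := LQC.tendsto_abs_mul_of_isBigO hB
  exact theorem1_general Λ ε _ A B (by rw [abs_of_pos (by positivity)]; linarith) hε
    ((LQC.tendsto_div_abs_of_hasCompactSupport_sub hA 2).comp hv)
    ((LQC.tendsto_add_div_of_tendsto_abs_mul hB' 4).comp hv)
    ((LQC.tendsto_abs_div_of_tendsto_abs_mul hB').comp hv) hBpos
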